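/- **Cauchy's Theorem for the massive Dirac equation.** Let $n\ge 0$ and let $C\ell_n$ be the real Clifford algebra with unit $1$ and generators $e_1,\dots,e_n$ satisfying $e_ie_j+e_je_i=2s\,\delta_{ij}$, where $s\in\mathbb R$ is fixed ($s=1$ and $s=-1$ are the two customary sign conventions). Let $\Omega\subset\mathbb R^{n+1}$, with points $y=(y_0,\dots,y_n)$, be a bounded Lipschitz domain, i.e. a bounded open set which near each boundary point is, in suitable Cartesian coordinates, the region on one side of the graph of a Lipschitz function; $\partial\Omega$ carries the boundary orientation. Put $$d\sigma_y = dy_1\wedge\dots\wedge dy_n-\sum_{j=1}^n(-1)^j e_j\,dy_0\wedge\dots\wedge[dy_j]\wedge\dots\wedge dy_n ,$$ where $[dy_j]$ means that $dy_j$ is omitted; thus $d(d\sigma\, g)=\big(\partial_{y_0}g-\sum_{j=1}^n e_j\,\partial_{y_j}g\big)\,dy_0\wedge\dots\wedge dy_n$. Integrals of $n$-forms over $\partial\Omega$ are computed from positively oriented Lipschitz graph parametrizations and a finite smooth partition of unity subordinate to them; the theorem holds for every choice of these, and it includes the integrability of the integrands. For a real Banach space $V$ that is a left $C\ell_n$-module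 on which each Clifford number acts as a bounded operator (for example $V=C\ell_n$), and a bounded linear operator $M$ on $V$ commuting with the action of $e_1,\dots,e_n$, let $\mathcal M_M(\Omega)$ be the set of functions $f:\overline\Omega\to V$ that are continuous on $\overline\Omega$, differentiable in $\Omega$, and satisfy $$\frac{\partial f}{\partial y_0}=\Big(\sum_{j=1}^n e_j\frac{\partial}{\partial y_j}+M\Big)f\quad\text{in }\Omega .$$ Then for every $f\in\mathcal M_M(\Omega)$ $$\int_{\partial\Omega}d\sigma_y\,e^{-y_0M}f(y)=0 .$$ In particular, let $V=C\ell_n$, let $\lambda\in C\ell_n$, and let $M=M_\lambda$ be the operator $a\mapsto a\lambda$ of multiplication by $\lambda$ from the right. Then for every $f\in\mathcal M_{M_\lambda}(\Omega)$ $$\int_{\partial\Omega}d\sigma_y\,f(y)\,e^{-y_0\lambda}=0 ,$$ and, if $\lambda\in\mathbb R$, also $$\int_{\partial\Omega}d\sigma_y\,e^{-y_0\lambda}\,f(y)=0 .$$ -/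

import Mathlib

open scoped NNReal ContDiff Topology

noncomputable section

/-! ### The Clifford algebra -/

/-- The quadratic form `x ↦ s (x₁² + ⋯ + xₙ²)` on `ℝⁿ`. -/
abbrev cliffordForm (n : ℕ) (s : ℝ) : QuadraticForm ℝ (Fin n → ℝ) :=
  QuadraticMap.weightedSumSquares ℝ (fun _ : Fin n => s)

/-- The real Clifford algebra with generators `e₁, …, eₙ` and relations
`e_i e_j + e_j e_i = 2 s δ_{ij}`; `s = 1` and `s = -1` are the two customary sign conventions. -/
abbrev Cl (n : ℕ) (s : ℝ) : Type := CliffordAlgebra (cliffordForm n s)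

/-- The generators `e₁, …, eₙ` (indexed by `Fin n`). -/
def gen (n : ℕ) (s : ℝ) (j : Fin n) : Cl n s :=
  CliffordAlgebra.ι (cliffordForm n s) (Pi.single j 1)

theorem gen_mul_gen_add (n : ℕ) (s : ℝ) (i j : Fin n) :
    gen n s i * gen n s j + gen n s j * gen n s i
      = algebraMap ℝ (Cl n s) (2 * s * (if i = j then 1 else 0)) := by
  unfold gen
  rw [CliffordAlgebra.ι_mul_ι_add_swap]
  congr 1
  simp only [QuadraticMap.polar, QuadraticMap.weightedSumSquares_apply, Pi.add_apply, smul_eq_mul,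
    ← Finset.sum_sub_distrib]
  have h : ∀ k : Fin n,
      s * (((Pi.single i 1 : Fin n → ℝ) k + (Pi.single j 1 : Fin n → ℝ) k) *
          ((Pi.single i 1 : Fin n → ℝ) k + (Pi.single j 1 : Fin n → ℝ) k)) -
        s * ((Pi.single i 1 : Fin n → ℝ) k * (Pi.single i 1 : Fin n → ℝ) k) -
        s * ((Pi.single j 1 : Fin n → ℝ) k * (Pi.single j 1 : Fin n → ℝ) k)
      = 2 * s * ((Pi.single i 1 : Fin n → ℝ) k * (Pi.single j 1 : Fin n → ℝ) k) := by
    intro k; ring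
  simp only [h, ← Finset.mul_sum]
  congr 1
  simp only [Pi.single_apply, mul_ite, mul_one, mul_zero]
  simp [eq_comm]

/-- The standard basis of the Clifford algebra, indexed by subsets of `{1, …, n}`. -/
def cliffordBasis (n : ℕ) (s : ℝ) : Module.Basis (Finset (Fin n)) ℝ (Cl n s) :=
  (Pi.basisFun ℝ (Fin n)).ExteriorAlgebra.map
    (CliffordAlgebra.equivExterior (cliffordForm n s)).symm

attribute [local instance] Matrix.linftyOpNormedRing Matrix.linftyOpNormedAlgebra in
/-- A (submultiplicative) norm on the finite-dimensional algebra `Cl n s`: the norm of the matrix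
of left multiplication. All norms on `Cl n s` being equivalent, the choice is immaterial. -/
instance instNormedRingCl (n : ℕ) (s : ℝ) : NormedRing (Cl n s) :=
  NormedRing.induced (Cl n s) (Matrix (Finset (Fin n)) (Finset (Fin n)) ℝ)
    (Algebra.leftMulMatrix (cliffordBasis n s))
    (Algebra.leftMulMatrix_injective (cliffordBasis n s))

attribute [local instance] Matrix.linftyOpNormedRing Matrix.linftyOpNormedAlgebra in
instance instNormedAlgebraCl (n : ℕ) (s : ℝ) : NormedAlgebra ℝ (Cl n s) :=
  NormedAlgebra.induced ℝ (Cl n s) (Matrix (Finset (Fin n)) (Finset (Fin n)) ℝ)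
    (Algebra.leftMulMatrix (cliffordBasis n s))

/-- The operator `M_λ` of multiplication by the Clifford number `λ` from the right. -/
def rightMul {n : ℕ} {s : ℝ} (l : Cl n s) : Cl n s →L[ℝ] Cl n s :=
  (ContinuousLinearMap.mul ℝ (Cl n s)).flip l

theorem rightMul_apply {n : ℕ} {s : ℝ} (l a : Cl n s) : rightMul l a = a * l := rfl

/-! ### The massive Dirac equation -/

/-- The space `ℝⁿ⁺¹` of points `y = (y₀, …, yₙ)`. -/
abbrev Pt (n : ℕ) : Type := EuclideanSpace ℝ (Fin (n + 1))

section Dirac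

variable {n : ℕ} (s : ℝ) {V : Type*} [NormedAddCommGroup V] [NormedSpace ℝ V] [Module (Cl n s) V]

/-- The partial derivative `∂f/∂y_j` at `y`. -/
def pderivAt (f : Pt n → V) (j : Fin (n + 1)) (y : Pt n) : V :=
  fderiv ℝ f y (EuclideanSpace.single j 1)

/-- The space of functions, continuous on the closure of `Ω`, that solve
`∂f/∂y₀ = (∑_{j=1}^n e_j ∂/∂y_j + M) f` in `Ω`. -/
def massiveDirac (Ω : Set (Pt n)) (M : V →L[ℝ] V) : Set (Pt n → V) :=
  {f | ContinuousOn f (closure Ω) ∧ DifferentiableOn ℝ f Ω ∧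
    ∀ y ∈ Ω, pderivAt f 0 y = (∑ j : Fin n, gen n s j • pderivAt f j.succ y) + M (f y)}

end Dirac

/-! ### Bounded Lipschitz domains and integration of `n`-forms over their boundary -/

/-- The vector `(t, u₁, …, uₙ)`. -/
def consPt {n : ℕ} (t : ℝ) (u : EuclideanSpace ℝ (Fin n)) : Pt n :=
  WithLp.toLp 2 (Fin.cons t (fun i => u i))

/-- The vector `(y₁, …, yₙ)`. -/
def tailPt {n : ℕ} (y : Pt n) : EuclideanSpace ℝ (Fin n) :=
  WithLp.toLp 2 (fun i => y i.succ)

/-- A boundary chart: in the open window `W`, and in the Cartesian coordinates given by the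
orthogonal transformation `A`, the set `Ω` is the region `y₀ < h (y₁, …, yₙ)` below the graph of a
Lipschitz function `h`. -/
structure BoundaryChart {n : ℕ} (Ω : Set (Pt n)) where
  A : Pt n ≃ₗᵢ[ℝ] Pt n
  h : EuclideanSpace ℝ (Fin n) → ℝ
  lipschitz : ∃ K : ℝ≥0, LipschitzWith K h
  W : Set (Pt n)
  isOpen_W : IsOpen W
  mem_iff : ∀ y ∈ W, y ∈ Ω ↔ (A.symm y) 0 < h (tailPt (A.symm y))

/-- A bounded Lipschitz domain: a bounded open set which near each of its boundary points is the
region on one side of the graph of a Lipschitz function. -/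
structure IsLipschitzDomain {n : ℕ} (Ω : Set (Pt n)) : Prop where
  isOpen : IsOpen Ω
  isBounded : Bornology.IsBounded Ω
  exists_chart : ∀ p ∈ frontier Ω, ∃ c : BoundaryChart Ω, p ∈ c.W

namespace BoundaryChart

variable {n : ℕ} {Ω : Set (Pt n)} (c : BoundaryChart Ω)

/-- The parametrization `u ↦ A (h u, u)` of the boundary. -/
def param (u : EuclideanSpace ℝ (Fin n)) : Pt n := c.A (consPt (c.h u) u)

/-- The tangent vectors `∂₁ψ(u), …, ∂ₙψ(u)` of the parametrization `ψ`; they exist for almost every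
`u`. -/
def tangent (u : EuclideanSpace ℝ (Fin n)) (i : Fin n) : Pt n :=
  fderiv ℝ c.param u (EuclideanSpace.single i 1)

/-- The orientation of the parametrization, `1` or `-1`. With `ν` the outward normal,
`det (ν, ∂₁ψ, …, ∂ₙψ)` has the sign of `det A`, because `Ω` lies below the graph. -/
def orientation : ℝ := LinearMap.det (c.A.toLinearEquiv : Pt n →ₗ[ℝ] Pt n)

end BoundaryChart

/-- A finite atlas of the boundary of `Ω` with a smooth partition of unity subordinate to it. -/
structure BoundaryAtlas {n : ℕ} (Ω : Set (Pt n)) where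
  m : ℕ
  chart : Fin m → BoundaryChart Ω
  χ : Fin m → Pt n → ℝ
  smooth : ∀ k, ContDiff ℝ ∞ (χ k)
  nonneg : ∀ k y, 0 ≤ χ k y
  tsupport_subset : ∀ k, tsupport (χ k) ⊆ (chart k).W
  sum_eq_one : ∀ᶠ y in 𝓝ˢ (frontier Ω), ∑ k, χ k y = 1

/-- Every bounded Lipschitz domain has an atlas as above. -/
theorem IsLipschitzDomain.nonempty_atlas {n : ℕ} {Ω : Set (Pt n)} (hΩ : IsLipschitzDomain Ω) :
    Nonempty (BoundaryAtlas Ω) := by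
  have hcpt : IsCompact (frontier Ω) :=
    hΩ.isBounded.isCompact_closure.of_isClosed_subset isClosed_frontier frontier_subset_closure
  choose c hc using hΩ.exists_chart
  obtain ⟨t, ht⟩ := hcpt.elim_finite_subcover (fun p : frontier Ω => (c p.1 p.2).W)
    (fun p => (c p.1 p.2).isOpen_W) (fun p hp => Set.mem_iUnion.2 ⟨⟨p, hp⟩, hc p hp⟩)
  let e := t.equivFin
  let ch : Fin t.card → BoundaryChart Ω := fun k => c (e.symm k).1.1 (e.symm k).1.2
  have hcov : frontier Ω ⊆ ⋃ k, (ch k).W := by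
    intro p hp
    obtain ⟨q, hq, hpq⟩ := Set.mem_iUnion₂.1 (ht hp)
    refine Set.mem_iUnion.2 ⟨e ⟨q, hq⟩, ?_⟩
    simpa [ch] using hpq
  obtain ⟨K, hK, hK1, hK2⟩ := exists_compact_between hcpt
    (isOpen_iUnion fun k => (ch k).isOpen_W) hcov
  obtain ⟨f, hf⟩ := SmoothPartitionOfUnity.exists_isSubordinate
    (modelWithCornersSelf ℝ (Pt n)) hK.isClosed (fun k => (ch k).W)
    (fun k => (ch k).isOpen_W) hK2
  refine ⟨⟨t.card, ch, fun k => f k, fun k => (f k).contMDiff.contDiff, fun k y => f.nonneg k y,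
    hf, ?_⟩⟩
  have h1 : interior K ∈ 𝓝ˢ (frontier Ω) := isOpen_interior.mem_nhdsSet.2 hK1
  filter_upwards [h1] with y hy
  rw [← finsum_eq_sum_of_fintype]
  exact f.sum_eq_one (interior_subset hy)

/-- The value on `(v₁, …, vₙ)` of the form `dy₀ ∧ … ∧ [dy_j] ∧ … ∧ dyₙ` (`dy_j` omitted). -/
def omitForm {n : ℕ} (j : Fin (n + 1)) (v : Fin n → Pt n) : ℝ :=
  Matrix.det (Matrix.of fun a b : Fin n => v b (j.succAbove a))

/-- The value on `(v₁, …, vₙ)` of the Clifford algebra valued oriented surface element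
`dσ = dy₁ ∧ … ∧ dyₙ - ∑_{j=1}^n (-1)^j e_j dy₀ ∧ … ∧ [dy_j] ∧ … ∧ dyₙ`. -/
def dσ {n : ℕ} (s : ℝ) (v : Fin n → Pt n) : Cl n s :=
  algebraMap ℝ (Cl n s) (omitForm 0 v)
    - ∑ j : Fin n, ((-1) ^ (j.val + 1) * omitForm j.succ v) • gen n s j

namespace BoundaryAtlas

variable {n : ℕ} {Ω : Set (Pt n)} (𝒜 : BoundaryAtlas Ω) (s : ℝ)
  {V : Type*} [NormedAddCommGroup V] [NormedSpace ℝ V] [Module (Cl n s) V]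

/-- The pull-back of the `n`-form `χ_k dσ g` under the `k`-th (oriented) parametrization. -/
def integrand (g : Pt n → V) (k : Fin 𝒜.m) (u : EuclideanSpace ℝ (Fin n)) : V :=
  ((𝒜.chart k).orientation * 𝒜.χ k ((𝒜.chart k).param u)) •
    dσ s ((𝒜.chart k).tangent u) • g ((𝒜.chart k).param u)

/-- `∫_{∂Ω} dσ g = I`: the form `dσ g` is integrable over the boundary, oriented as the boundary of
`Ω`, and its integral is `I`. -/
def HasBoundaryIntegral (g : Pt n → V) (I : V) : Prop :=
  (∀ k, MeasureTheory.Integrable (𝒜.integrand s g k)) ∧ ∑ k, ∫ u, 𝒜.integrand s g k u = I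

end BoundaryAtlas

end

/-!
The factor `e^{-y₀M}` commutes with the generators and removes the mass term, so
`g = e^{-y₀M} f` solves `∂₀g = ∑ e_j ∂_j g` (`hasBoundaryIntegral_exp_smul_apply`). For a bounded
functional `ℓ` this says that the real vector field `F = (ℓ(g), -ℓ(e₁g), …, -ℓ(eₙg))` has vanishing
divergence, and `ℓ` of the boundary integral of `dσ g` is the flux of `F` through `∂Ω`
(`BoundaryAtlas.hasBoundaryIntegral_zero_of_dirac`). It remains to prove the divergence theorem for
a field `F` that is continuous up to the Lipschitz boundary and merely differentiable inside.

* The divergence theorem on boxes needs only the divergence to be integrable, not the single partial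
  derivatives. Applied to `φ F` it gives `∫ dφ(F) = 0` for every `C¹` function `φ` with compact
  support in `Ω` (`integral_fderiv_apply_eq_zero_of_divergence_eq_zero`). From here on the
  derivatives of `F` play no role, and `F` may be extended to a continuous field on `ℝⁿ⁺¹`.
* In a chart, `Ω` is the region `t < h(u)`. The equation `∫ dφ(F) = 0` with
  `φ = χ η((t - h_ε(u)) / ε)`, where `η` is a step function and `h_ε` a mollification of `h`, tends
  to `∫_{t < h} dχ(F) = ∫ χ (F₀ - Dh(F'))(h(u), u) du` as `ε → 0`
  (`integral_subgraph_eq_of_weakly_divergence_free`). Here `Dh_ε → Dh` almost everywhere, by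
  Rademacher's theorem and Lebesgue's differentiation theorem. The right-hand side is the flux of
  `χ F` (`BoundaryChart.orientation_mul_sum_omitForm`).
* Summed over the partition of unity, the flux of `F` is `∫_Ω d(∑ χ_k - 1)(F)`. As `∑ χ_k - 1`
  vanishes near `∂Ω`, its restriction to `Ω` is a test function, and the integral is `0`
  (`BoundaryAtlas.sum_flux_eq_zero`).
-/

section

open MeasureTheory Filter Set Function

/-! ### Smoothing of Lipschitz functions -/

/-- The derivative of a mollified Lipschitz function is the mollification of its derivative, which
exists almost everywhere by Rademacher's theorem. -/
theorem LipschitzWith.hasFDerivAt_normed_convolution {E : Type*} [NormedAddCommGroup E]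
    [NormedSpace ℝ E] [FiniteDimensional ℝ E] [MeasurableSpace E] [BorelSpace E] (μ : Measure E)
    [μ.IsAddHaarMeasure] {h : E → ℝ} {K : ℝ≥0} (hh : LipschitzWith K h)
    (ρ : ContDiffBump (0 : E)) (x : E) :
    HasFDerivAt (convolution (ρ.normed μ) h (ContinuousLinearMap.lsmul ℝ ℝ) μ)
      (convolution (ρ.normed μ) (fderiv ℝ h) (ContinuousLinearMap.lsmul ℝ ℝ) μ x) x := by
  have hρi : Integrable (ρ.normed μ) μ := ρ.integrable_normed
  have hρc : Continuous (ρ.normed μ) := ρ.contDiff_normed (n := 0) |>.continuous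
  have key := hasFDerivAt_integral_of_dominated_loc_of_lip (𝕜 := ℝ) (μ := μ) (s := univ)
    (F := fun x t => ρ.normed μ t • h (x - t)) (F' := fun t => ρ.normed μ t • fderiv ℝ h (x - t))
    (bound := fun t => ρ.normed μ t * K) (x₀ := x) univ_mem ?_ ?_ ?_ ?_ ?_ ?_
  · exact key.2
  · refine Eventually.of_forall fun x => ?_
    exact (hρc.smul (hh.continuous.comp (continuous_const.sub continuous_id))).aestronglyMeasurable
  · refine Continuous.integrable_of_hasCompactSupport ?_ ?_
    · exact (hρc.smul (hh.continuous.comp (continuous_const.sub continuous_id)))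
    · exact ρ.hasCompactSupport_normed.smul_right
  · exact (hρc.measurable.smul ((measurable_fderiv ℝ h).comp
      (measurable_const.sub measurable_id))).aestronglyMeasurable
  · refine Eventually.of_forall fun t => LipschitzOnWith.of_dist_le_mul fun a _ b _ => ?_
    have h0 := ρ.nonneg_normed (μ := μ) t
    have h1 := hh.dist_le_mul (a - t) (b - t)
    rw [dist_sub_right] at h1
    simp only [Real.coe_nnabs, abs_of_nonneg (mul_nonneg h0 K.coe_nonneg)]
    rw [dist_smul₀, Real.norm_of_nonneg h0, mul_assoc]
    exact mul_le_mul_of_nonneg_left h1 h0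
  · exact hρi.mul_const _
  · have h1 : ∀ᵐ t ∂μ, DifferentiableAt ℝ h (x - t) :=
      (Measure.measurePreserving_sub_left μ x).quasiMeasurePreserving.ae hh.ae_differentiableAt
    filter_upwards [h1] with t ht
    have := (ht.hasFDerivAt.comp x ((hasFDerivAt_id x).sub_const t)).const_smul (ρ.normed μ t)
    exact this

/-- A Lipschitz function is the uniform limit of `C¹` functions with the same Lipschitz constant
whose derivatives converge almost everywhere. -/
theorem LipschitzWith.exists_seq_contDiff_approx {E : Type*} [NormedAddCommGroup E]
    [NormedSpace ℝ E] [FiniteDimensional ℝ E] [MeasurableSpace E] [BorelSpace E] (μ : Measure E)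
    [μ.IsAddHaarMeasure] {h : E → ℝ} {K : ℝ≥0} (hh : LipschitzWith K h) :
    ∃ H : ℕ → E → ℝ, (∀ m, ContDiff ℝ 1 (H m)) ∧ (∀ m u, |H m u - h u| ≤ K * (1 / (m + 1))) ∧
      (∀ m u, ‖fderiv ℝ (H m) u‖ ≤ K) ∧
      ∀ᵐ u ∂μ, Tendsto (fun m => fderiv ℝ (H m) u) atTop (𝓝 (fderiv ℝ h u)) := by
  have hpos : ∀ m : ℕ, (0 : ℝ) < 1 / (m + 1) := fun m => Nat.one_div_pos_of_nat
  let ρ : ℕ → ContDiffBump (0 : E) := fun m =>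
    ⟨1 / (m + 1) / 2, 1 / (m + 1), half_pos (hpos m), half_lt_self (hpos m)⟩
  let H : ℕ → E → ℝ := fun m =>
    convolution ((ρ m).normed μ) h (ContinuousLinearMap.lsmul ℝ ℝ) μ
  have hloc : LocallyIntegrable (fderiv ℝ h) μ := by
    refine (locallyIntegrable_const (K : ℝ)).mono
      (measurable_fderiv ℝ h).aestronglyMeasurable (Eventually.of_forall fun u => ?_)
    rw [Real.norm_of_nonneg K.coe_nonneg]
    exact norm_fderiv_le_of_lipschitz ℝ hh
  refine ⟨H, fun m => ?_, fun m u => ?_, fun m u => ?_, ?_⟩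
  · exact (ρ m).hasCompactSupport_normed.contDiff_convolution_left _ (ρ m).contDiff_normed
      hh.continuous.locallyIntegrable
  · rw [← Real.dist_eq]
    refine (ρ m).dist_normed_convolution_le hh.continuous.aestronglyMeasurable fun x hx => ?_
    exact (hh.dist_le_mul x u).trans
      (mul_le_mul_of_nonneg_left (Metric.mem_ball.1 hx).le K.coe_nonneg)
  · rw [(hh.hasFDerivAt_normed_convolution μ (ρ m) u).fderiv]
    have h1 : ‖∫ t, (ρ m).normed μ t • fderiv ℝ h (u - t) ∂μ‖ ≤ ∫ t, (ρ m).normed μ t * K ∂μ := by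
      refine norm_integral_le_of_norm_le ((ρ m).integrable_normed.mul_const _)
        (Eventually.of_forall fun t => ?_)
      rw [norm_smul, Real.norm_of_nonneg ((ρ m).nonneg_normed t)]
      exact mul_le_mul_of_nonneg_left (norm_fderiv_le_of_lipschitz ℝ hh) ((ρ m).nonneg_normed t)
    rw [integral_mul_const, (ρ m).integral_normed, one_mul] at h1
    exact h1
  · have := ContDiffBump.ae_convolution_tendsto_right_of_locallyIntegrable (μ := μ) (φ := ρ)
      (l := atTop) (K := 2) tendsto_one_div_add_atTop_nhds_zero_nat
      (Eventually.of_forall fun m => by simp [ρ]; linarith) hloc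
    filter_upwards [this] with u hu
    refine hu.congr fun m => ?_
    exact ((hh.hasFDerivAt_normed_convolution μ (ρ m) u).fderiv).symm

/-! ### The divergence theorem below a Lipschitz graph -/

/-- A smooth step from `1` to `0` on `[-(a + 1), -a]`. -/
theorem exists_contDiff_step (a : ℝ) :
    ∃ η : ℝ → ℝ, ContDiff ℝ 1 η ∧ (∀ t, t ≤ -(a + 1) → η t = 1) ∧ (∀ t, -a ≤ t → η t = 0) ∧
      (∀ t, |η t| ≤ 1) ∧ HasCompactSupport (deriv η) ∧ ∫ t, deriv η t = -1 := by
  let η : ℝ → ℝ := fun t => Real.smoothTransition (-a - t)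
  have hη : ContDiff ℝ 1 η :=
    Real.smoothTransition.contDiff.comp (contDiff_const.sub contDiff_id)
  have h1 : ∀ t, t ≤ -(a + 1) → η t = 1 := fun t ht =>
    Real.smoothTransition.one_of_one_le (by linarith)
  have h0 : ∀ t, -a ≤ t → η t = 0 := fun t ht =>
    Real.smoothTransition.zero_of_nonpos (by linarith)
  have hc : HasCompactSupport (deriv η) := by
    refine HasCompactSupport.intro (isCompact_Icc (a := -(a + 1)) (b := -a)) fun t ht => ?_
    rcases lt_or_ge t (-(a + 1)) with h | h
    · have : η =ᶠ[𝓝 t] fun _ => 1 := by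
        filter_upwards [Iio_mem_nhds h] with s hs using h1 s (le_of_lt hs)
      rw [this.deriv_eq, deriv_const]
    · have h' : -a < t := lt_of_not_ge fun h2 => ht ⟨h, h2⟩
      have : η =ᶠ[𝓝 t] fun _ => 0 := by
        filter_upwards [Ioi_mem_nhds h'] with s hs using h0 s (le_of_lt hs)
      rw [this.deriv_eq, deriv_const]
  refine ⟨η, hη, h1, h0, fun t => ?_, hc, ?_⟩
  · rw [abs_of_nonneg (Real.smoothTransition.nonneg _)]
    exact Real.smoothTransition.le_one _
  · have := integral_of_hasDerivAt_of_tendsto (f := η) (f' := deriv η) (m := 1) (n := 0)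
      (fun t => (hη.differentiable one_ne_zero t).hasDerivAt)
      ((hη.continuous_deriv le_rfl).integrable_of_hasCompactSupport hc)
      (tendsto_const_nhds.congr' (by
        filter_upwards [Iic_mem_atBot (-(a + 1))] with t ht using (h1 t ht).symm))
      (tendsto_const_nhds.congr' (by
        filter_upwards [Ici_mem_atTop (-a)] with t ht using (h0 t ht).symm))
    rw [this]; norm_num

/-- The substitution `t = c + ε τ`. -/
theorem integral_step_comp {ε : ℝ} (hε : 0 < ε) (c : ℝ) (g : ℝ → ℝ) (d : ℝ → ℝ) :
    ∫ t, g t * (d ((t - c) / ε) * (1 / ε)) = ∫ τ, g (c + ε * τ) * d τ := by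
  have h1 := integral_sub_right_eq_self (μ := volume)
    (fun t => g (t + c) * (d (t / ε) * (1 / ε))) c
  simp only [sub_add_cancel] at h1
  rw [h1]
  have h2 := Measure.integral_comp_mul_left (fun t => g (t + c) * (d (t / ε) * (1 / ε))) ε
  rw [smul_eq_mul, abs_of_pos (inv_pos.2 hε)] at h2
  have h3 := congrArg (fun x => ε * x) h2
  simp only [mul_inv_cancel_left₀ hε.ne'] at h3
  rw [← h3, ← integral_const_mul]
  refine integral_congr_ae (Eventually.of_forall fun τ => ?_)
  simp only [mul_div_cancel_left₀ _ hε.ne', add_comm c]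
  field_simp

/-- The divergence theorem for a weakly divergence-free continuous vector field `F` on the region
below a Lipschitz graph. The region is exhausted by the test functions
`χ(t, u) η((t - H_m u) / ε_m)`, where `η` is a step function and `H_m` are smooth approximations
of `h`; the step contributes the boundary integral in the limit. -/
theorem integral_subgraph_eq_of_weakly_divergence_free {E : Type*} [NormedAddCommGroup E]
    [NormedSpace ℝ E] [FiniteDimensional ℝ E] [MeasurableSpace E] [BorelSpace E] (μ : Measure E)
    [μ.IsAddHaarMeasure] {h : E → ℝ} {K : ℝ≥0} (hh : LipschitzWith K h) {W : Set (ℝ × E)}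
    {F : ℝ × E → ℝ × E} (hF : Continuous F)
    (hdiv : ∀ φ : ℝ × E → ℝ, ContDiff ℝ 1 φ → HasCompactSupport φ →
      tsupport φ ⊆ {p ∈ W | p.1 < h p.2} → ∫ p, fderiv ℝ φ p (F p) ∂(volume.prod μ) = 0)
    {χ : ℝ × E → ℝ} (hχ : ContDiff ℝ 1 χ) (hχc : HasCompactSupport χ) (hχW : tsupport χ ⊆ W) :
    ∫ p in {p : ℝ × E | p.1 < h p.2}, fderiv ℝ χ p (F p) ∂(volume.prod μ) =
      ∫ u, χ (h u, u) * ((F (h u, u)).1 - fderiv ℝ h u (F (h u, u)).2) ∂μ := by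
  obtain ⟨H, hH, hHh, hHK, hHlim⟩ := hh.exists_seq_contDiff_approx μ
  obtain ⟨η, hη, hη1, hη0, hηle, hηc, hηint⟩ := exists_contDiff_step ((K : ℝ) + 1)
  let ε : ℕ → ℝ := fun m => 1 / (m + 1)
  have hε : ∀ m, 0 < ε m := fun m => Nat.one_div_pos_of_nat
  have hε0 : Tendsto ε atTop (𝓝 0) := tendsto_one_div_add_atTop_nhds_zero_nat
  let τ : ℕ → ℝ × E → ℝ := fun m p => (p.1 - H m p.2) / ε m
  have hτ : ∀ m, ContDiff ℝ 1 (τ m) := fun m =>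
    (contDiff_fst.sub ((hH m).comp contDiff_snd)).div_const _
  -- the scaled heights above the graphs of `H m` and `h` differ by at most `K`
  have hτh : ∀ m p, |τ m p - (p.1 - h p.2) / ε m| ≤ K := by
    intro m p
    have : τ m p - (p.1 - h p.2) / ε m = -(H m p.2 - h p.2) / ε m := by
      simp only [τ]; ring
    rw [this, abs_div, abs_neg, abs_of_pos (hε m), div_le_iff₀ (hε m)]
    exact hHh m p.2
  have hη' : Continuous (deriv η) := hη.continuous_deriv le_rfl
  have hdχ : Continuous fun p => fderiv ℝ χ p (F p) :=
    (hχ.continuous_fderiv one_ne_zero).clm_apply hF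
  have hdχc : HasCompactSupport fun p => fderiv ℝ χ p (F p) :=
    (hχc.fderiv (𝕜 := ℝ)).mono fun p hp h0 => hp (by simp [show fderiv ℝ χ p = 0 from h0])
  let A : ℕ → ℝ × E → ℝ := fun m p => η (τ m p) * fderiv ℝ χ p (F p)
  let G : ℕ → ℝ × E → ℝ := fun m p => χ p * ((F p).1 - fderiv ℝ (H m) p.2 (F p).2)
  let B : ℕ → ℝ × E → ℝ := fun m p => G m p * (deriv η (τ m p) * (1 / ε m))
  have hG : ∀ m, Continuous (G m) := fun m =>
    hχ.continuous.mul (hF.fst.sub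
      ((((hH m).continuous_fderiv one_ne_zero).comp continuous_snd).clm_apply hF.snd))
  have hAi : ∀ m, Integrable (A m) (volume.prod μ) := fun m =>
    ((hη.continuous.comp (hτ m).continuous).mul hdχ).integrable_of_hasCompactSupport hdχc.mul_left
  have hBi : ∀ m, Integrable (B m) (volume.prod μ) := fun m =>
    ((hG m).mul ((hη'.comp (hτ m).continuous).mul continuous_const)).integrable_of_hasCompactSupport
      hχc.mul_right.mul_right
  -- the weak equation for the test function `χ η(τ_m)`
  have hAB : ∀ m, ∫ p, A m p ∂(volume.prod μ) + ∫ p, B m p ∂(volume.prod μ) = 0 := by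
    intro m
    rw [← integral_add (hAi m) (hBi m), ← hdiv (fun p => χ p * η (τ m p))
      (hχ.mul (hη.comp (hτ m))) hχc.mul_right ?_]
    · refine integral_congr_ae (Eventually.of_forall fun p => ?_)
      have e1 := (hχ.differentiable one_ne_zero p).hasFDerivAt
      have e2 : HasFDerivAt (τ m) _ p := (((hasFDerivAt_fst (𝕜 := ℝ) (p := p)).sub
        (((hH m).differentiable one_ne_zero p.2).hasFDerivAt.comp p
          hasFDerivAt_snd)).mul_const (ε m)⁻¹)
      have e3 := ((hη.differentiable one_ne_zero (τ m p)).hasDerivAt).comp_hasFDerivAt p e2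
      have e4 := (e1.mul e3).fderiv
      simp only [A, B, G]
      change _ = fderiv ℝ (χ * (η ∘ τ m)) p (F p)
      rw [e4]
      simp
      ring
    · have hcl : IsClosed {p : ℝ × E | τ m p ≤ -((K : ℝ) + 1)} :=
        isClosed_le (hτ m).continuous continuous_const
      have h1 : tsupport (fun p => χ p * η (τ m p)) ⊆ {p : ℝ × E | τ m p ≤ -((K : ℝ) + 1)} := by
        refine closure_minimal (fun p hp => ?_) hcl
        by_contra hlt
        exact hp (by simp [hη0 _ (not_le.1 hlt).le])
      intro p hp
      refine ⟨hχW (tsupport_mul_subset_left hp), ?_⟩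
      have h2 := abs_le.1 (hτh m p)
      have h3 : (p.1 - h p.2) / ε m < 0 := by
        have : τ m p ≤ -((K : ℝ) + 1) := h1 hp
        linarith
      rw [div_lt_iff₀ (hε m)] at h3
      linarith
  have hS : MeasurableSet {p : ℝ × E | p.1 < h p.2} :=
    measurableSet_lt measurable_fst (hh.continuous.measurable.comp measurable_snd)
  have hA : Tendsto (fun m => ∫ p, A m p ∂(volume.prod μ)) atTop
      (𝓝 (∫ p in {p : ℝ × E | p.1 < h p.2}, fderiv ℝ χ p (F p) ∂(volume.prod μ))) := by
    rw [← integral_indicator hS]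
    refine tendsto_integral_of_dominated_convergence (fun p => ‖fderiv ℝ χ p (F p)‖)
      (fun m => (hAi m).aestronglyMeasurable)
      (hdχ.integrable_of_hasCompactSupport hdχc).norm
      (fun m => Eventually.of_forall fun p => ?_) (Eventually.of_forall fun p => ?_)
    · rw [norm_mul]
      exact mul_le_of_le_one_left (norm_nonneg _) (hηle _)
    · by_cases hp : p.1 < h p.2
      · rw [indicator_of_mem (show p ∈ {p : ℝ × E | p.1 < h p.2} from hp)]
        have hlim : Tendsto (fun m => (p.1 - h p.2) / ε m) atTop atBot := by
          have := (tendsto_natCast_atTop_atTop (R := ℝ)).atTop_add (tendsto_const_nhds (x := (1:ℝ)))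
          refine (this.const_mul_atTop_of_neg (sub_neg.2 hp)).congr fun m => ?_
          simp [ε]
        refine tendsto_const_nhds.congr' ?_
        filter_upwards [hlim.eventually_le_atBot (-((K : ℝ) + 1 + 1) - K)] with m hm
        have h2 := abs_le.1 (hτh m p)
        simp only [A]
        rw [hη1 _ (by linarith), one_mul]
      · rw [indicator_of_notMem (show p ∉ {p : ℝ × E | p.1 < h p.2} from hp)]
        refine tendsto_const_nhds.congr fun m => ?_
        have h2 := abs_le.1 (hτh m p)
        have h3 : 0 ≤ (p.1 - h p.2) / ε m := div_nonneg (by linarith) (hε m).le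
        simp only [A]
        rw [hη0 _ (by linarith), zero_mul]
  have hB : Tendsto (fun m => ∫ p, B m p ∂(volume.prod μ)) atTop
      (𝓝 (∫ u, -(χ (h u, u) * ((F (h u, u)).1 - fderiv ℝ h u (F (h u, u)).2)) ∂μ)) := by
    -- after the substitution `t = H_m u + ε_m σ` the integrand converges for fixed `σ`
    have hBu : ∀ m u, ∫ t, B m (t, u) = ∫ σ, G m (H m u + ε m * σ, u) * deriv η σ :=
      fun m u => integral_step_comp (hε m) (H m u) (fun t => G m (t, u)) (deriv η)
    obtain ⟨C, hC⟩ := (hχ.continuous.smul hF).bounded_above_of_compact_support hχc.smul_right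
    have hC0 : 0 ≤ C := (norm_nonneg _).trans (hC 0)
    have hGb : ∀ m p, ‖G m p‖ ≤ (1 + K) * C := by
      intro m p
      have hp : |χ p| * ‖F p‖ ≤ C := by simpa [norm_smul] using hC p
      have h1 : |(F p).1| ≤ ‖F p‖ := norm_fst_le (F p)
      have h2 : |fderiv ℝ (H m) p.2 (F p).2| ≤ K * ‖F p‖ :=
        ((fderiv ℝ (H m) p.2).le_of_opNorm_le (hHK m p.2) _).trans
          (mul_le_mul_of_nonneg_left (norm_snd_le _) K.coe_nonneg)
      have h3 : |(F p).1 - fderiv ℝ (H m) p.2 (F p).2| ≤ (1 + K) * ‖F p‖ := by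
        refine (abs_sub _ _).trans ?_
        linarith
      simp only [G, norm_mul, Real.norm_eq_abs]
      calc |χ p| * |(F p).1 - fderiv ℝ (H m) p.2 (F p).2| ≤ |χ p| * ((1 + K) * ‖F p‖) :=
            mul_le_mul_of_nonneg_left h3 (abs_nonneg _)
        _ = (1 + K) * (|χ p| * ‖F p‖) := by ring
        _ ≤ _ := mul_le_mul_of_nonneg_left hp (by positivity)
    have hdη : Integrable (deriv η) := hη'.integrable_of_hasCompactSupport hηc
    have hbd : ∀ m u σ, ‖G m (H m u + ε m * σ, u) * deriv η σ‖ ≤ (1 + K) * C * ‖deriv η σ‖ :=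
      fun m u σ => by
        rw [norm_mul]; exact mul_le_mul_of_nonneg_right (hGb _ _) (norm_nonneg _)
    have hQ : IsCompact (Prod.snd '' tsupport χ) := hχc.isCompact.image continuous_snd
    have hGcont : ∀ m u, Continuous fun σ => G m (H m u + ε m * σ, u) := fun m u =>
      (hG m).comp (by fun_prop)
    simp only [fun m => integral_prod_symm (B m) (hBi m)]
    refine tendsto_integral_of_dominated_convergence
      ((Prod.snd '' tsupport χ).indicator fun _ => (1 + K) * C * ∫ σ, ‖deriv η σ‖)
      (fun m => (hBi m).integral_prod_right.aestronglyMeasurable)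
      ((integrable_indicator_iff hQ.measurableSet).2 (integrableOn_const hQ.measure_lt_top.ne))
      (fun m => Eventually.of_forall fun u => ?_) ?_
    · by_cases hu : u ∈ Prod.snd '' tsupport χ
      · rw [indicator_of_mem hu, hBu, ← integral_const_mul]
        exact norm_integral_le_of_norm_le (hdη.norm.const_mul _)
          (Eventually.of_forall fun σ => hbd m u σ)
      · rw [indicator_of_notMem hu]
        have : ∀ t, B m (t, u) = 0 := fun t => by
          have : χ (t, u) = 0 := image_eq_zero_of_notMem_tsupport fun h' => hu ⟨_, h', rfl⟩
          simp [B, G, this]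
        simp [this]
    · filter_upwards [hHlim] with u hu
      simp only [hBu]
      have hlim := tendsto_integral_of_dominated_convergence
        (F := fun m σ => G m (H m u + ε m * σ, u) * deriv η σ) (μ := volume)
        (f := fun σ => χ (h u, u) * ((F (h u, u)).1 - fderiv ℝ h u (F (h u, u)).2) * deriv η σ)
        (fun σ => (1 + K) * C * ‖deriv η σ‖)
        (fun m => ((hGcont m u).mul hη').aestronglyMeasurable) (hdη.norm.const_mul _)
        (fun m => Eventually.of_forall fun σ => hbd m u σ)
        (Eventually.of_forall fun σ => ?_)
      · rw [integral_const_mul, hηint, mul_neg_one] at hlim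
        exact hlim
      · have hHu : Tendsto (fun m => H m u) atTop (𝓝 (h u)) := by
          rw [tendsto_iff_dist_tendsto_zero]
          refine squeeze_zero (fun _ => dist_nonneg) (fun m => hHh m u) ?_
          have := hε0.const_mul (K : ℝ)
          rwa [mul_zero] at this
        have hp : Tendsto (fun m => (H m u + ε m * σ, u)) atTop (𝓝 (h u, u)) := by
          have := hHu.add (hε0.mul_const σ)
          rw [zero_mul, add_zero] at this
          exact this.prodMk_nhds tendsto_const_nhds
        have hFp := (hF.tendsto (h u, u)).comp hp
        have hχp := (hχ.continuous.tendsto (h u, u)).comp hp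
        have hFu := (isBoundedBilinearMap_apply (𝕜 := ℝ) (E := E) (F := ℝ)).continuous.tendsto
          (fderiv ℝ h u, (F (h u, u)).2)
        exact (hχp.mul (hFp.fst_nhds.sub (hFu.comp (hu.prodMk_nhds hFp.snd_nhds)))).mul_const _
  have hlim := hA.add hB
  simp only [hAB] at hlim
  have := tendsto_nhds_unique hlim tendsto_const_nhds
  rw [integral_neg] at this
  linarith

/-! ### Weakly divergence-free vector fields -/

/-- The integral of the divergence of a compactly supported differentiable vector field vanishes as
soon as the divergence is integrable; the partial derivatives need not be. -/
theorem integral_divergence_eq_zero_of_hasCompactSupport {n : ℕ} {f : Pt n → Pt n}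
    (hf : Differentiable ℝ f) (hc : HasCompactSupport f)
    (hi : Integrable fun y => ∑ i, fderiv ℝ f y (EuclideanSpace.single i 1) i) :
    ∫ y, ∑ i, fderiv ℝ f y (EuclideanSpace.single i 1) i = 0 := by
  let e : Pt n ≃L[ℝ] (Fin (n + 1) → ℝ) := EuclideanSpace.equiv (Fin (n + 1)) ℝ
  have he : MeasurePreserving (MeasurableEquiv.toLp 2 (Fin (n + 1) → ℝ)) volume volume :=
    PiLp.volume_preserving_toLp (Fin (n + 1))
  obtain ⟨R, hR⟩ := hc.isCompact.isBounded.subset_closedBall (0 : Pt n)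
  let r : ℝ := |R| + 1
  have hr : R < r := (le_abs_self R).trans_lt (lt_add_one _)
  have hr0 : 0 < r := by positivity
  have hzero : ∀ x : Fin (n + 1) → ℝ, ∀ i, r ≤ |x i| → f (e.symm x) = 0 := by
    intro x i hx
    refine image_eq_zero_of_notMem_tsupport fun h => ?_
    have h1 := mem_closedBall_zero_iff.1 (hR h)
    have h2 := PiLp.norm_apply_le (e.symm x) i
    rw [Real.norm_eq_abs] at h2
    exact absurd (hx.trans (h2.trans h1)) (not_le.2 hr)
  let g : (Fin (n + 1) → ℝ) → Fin (n + 1) → ℝ := fun x => e (f (e.symm x))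
  let g' : (Fin (n + 1) → ℝ) → (Fin (n + 1) → ℝ) →L[ℝ] (Fin (n + 1) → ℝ) := fun x =>
    (e : Pt n →L[ℝ] _).comp ((fderiv ℝ f (e.symm x)).comp (e.symm : _ →L[ℝ] Pt n))
  have hg : ∀ x, HasFDerivAt g (g' x) x := fun x =>
    e.hasFDerivAt.comp x ((hf (e.symm x)).hasFDerivAt.comp x e.symm.hasFDerivAt)
  have hint : Integrable fun x => ∑ i, g' x (Pi.single i 1) i :=
    (he.integrable_comp_emb (MeasurableEquiv.measurableEmbedding _)).2 hi
  have key := integral_divergence_of_hasFDerivAt_off_countable (fun _ => -r) (fun _ => r)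
    (fun _ => by linarith) g g' ∅ countable_empty
    (fun x _ => (hg x).continuousAt.continuousWithinAt) (fun x _ => hg x) hint.integrableOn
  have hrhs : ∀ (i : Fin (n + 1)) (c : ℝ) (x : Fin n → ℝ), r ≤ |c| →
      g (i.insertNth c x) i = 0 := by
    intro i c x hcr
    simp only [g]
    rw [hzero _ i (by simpa using hcr), map_zero, Pi.zero_apply]
  simp only [hrhs _ r _ (le_abs_self r), hrhs _ (-r) _ (by rw [abs_neg]; exact le_abs_self r),
    integral_zero, sub_zero, Finset.sum_const_zero] at key
  rw [setIntegral_eq_integral_of_forall_compl_eq_zero] at key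
  · rw [← key]
    exact (he.integral_comp (MeasurableEquiv.measurableEmbedding _) _).symm
  · intro x hx
    obtain ⟨i, hi'⟩ : ∃ i, r < |x i| := by
      by_contra! hall
      exact hx ⟨fun i => (abs_le.1 (hall i)).1, fun i => (abs_le.1 (hall i)).2⟩
    have hx0 : g =ᶠ[𝓝 x] fun _ => 0 := by
      have : {z : Fin (n + 1) → ℝ | r < |z i|} ∈ 𝓝 x :=
        (isOpen_lt continuous_const (continuous_apply i).abs).mem_nhds hi'
      filter_upwards [this] with z hz
      simp only [g]
      rw [hzero z i (le_of_lt hz), map_zero]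
    have : g' x = 0 := (hg x).unique ((hasFDerivAt_const _ _).congr_of_eventuallyEq hx0)
    simp [this]

/-- A continuous vector field that is differentiable in `Ω` with vanishing divergence is weakly
divergence-free in `Ω`. -/
theorem integral_fderiv_apply_eq_zero_of_divergence_eq_zero {n : ℕ} {Ω : Set (Pt n)}
    (hΩ : IsOpen Ω) {F : Pt n → Pt n} (hF : Continuous F) (hd : DifferentiableOn ℝ F Ω)
    (hdiv : ∀ y ∈ Ω, ∑ i, fderiv ℝ F y (EuclideanSpace.single i 1) i = 0)
    {φ : Pt n → ℝ} (hφ : ContDiff ℝ 1 φ) (hφc : HasCompactSupport φ) (hφΩ : tsupport φ ⊆ Ω) :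
    ∫ y, fderiv ℝ φ y (F y) = 0 := by
  have hder : ∀ y, ∃ f' : Pt n →L[ℝ] Pt n, HasFDerivAt (fun y => φ y • F y) f' y ∧
      ∑ i, f' (EuclideanSpace.single i 1) i = fderiv ℝ φ y (F y) := by
    intro y
    by_cases hy : y ∈ tsupport φ
    · refine ⟨_, (hφ.differentiable one_ne_zero y).hasFDerivAt.smul
        ((hd y (hφΩ hy)).differentiableAt (hΩ.mem_nhds (hφΩ hy))).hasFDerivAt, ?_⟩
      have h1 : F y = ∑ i, F y i • EuclideanSpace.single i (1 : ℝ) := by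
        simpa using ((EuclideanSpace.basisFun (Fin (n + 1)) ℝ).sum_repr (F y)).symm
      conv_rhs => rw [h1, map_sum]
      simp [Finset.sum_add_distrib, ← Finset.mul_sum, hdiv y (hφΩ hy), mul_comm]
    · refine ⟨0, (hasFDerivAt_const (0 : Pt n) y).congr_of_eventuallyEq ?_, ?_⟩
      · filter_upwards [(isClosed_tsupport φ).isOpen_compl.mem_nhds hy] with z hz
        rw [image_eq_zero_of_notMem_tsupport hz, zero_smul]
      · have : fderiv ℝ φ y = 0 :=
          image_eq_zero_of_notMem_tsupport fun h => hy (tsupport_fderiv_subset ℝ h)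
        simp [this]
  choose f' hf' hdivf using hder
  have hfd : ∀ y, ∑ i, fderiv ℝ (fun y => φ y • F y) y (EuclideanSpace.single i 1) i =
      fderiv ℝ φ y (F y) := fun y => by rw [(hf' y).fderiv, hdivf]
  have hi : Integrable fun y => fderiv ℝ φ y (F y) :=
    ((hφ.continuous_fderiv one_ne_zero).clm_apply hF).integrable_of_hasCompactSupport
      ((hφc.fderiv (𝕜 := ℝ)).mono fun p hp h0 => hp (by simp [show fderiv ℝ φ p = 0 from h0]))
  have := integral_divergence_eq_zero_of_hasCompactSupport (f := fun y => φ y • F y)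
    (fun y => (hf' y).differentiableAt) hφc.smul_right (by simpa only [hfd] using hi)
  simpa only [hfd] using this

/-! ### Boundary charts in Cartesian coordinates -/

theorem measurePreserving_consPt (n : ℕ) :
    MeasurePreserving (fun p : ℝ × EuclideanSpace ℝ (Fin n) => consPt p.1 p.2)
      (volume.prod volume) volume := by
  have h := (PiLp.volume_preserving_toLp (Fin (n + 1))).comp
    (((volume_preserving_piFinSuccAbove (fun _ : Fin (n + 1) => ℝ) 0).symm _).comp
      ((MeasurePreserving.id volume).prod (PiLp.volume_preserving_ofLp (Fin n))))
  have e : (fun p : ℝ × EuclideanSpace ℝ (Fin n) => consPt p.1 p.2) =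
      (WithLp.toLp 2 : (Fin (n + 1) → ℝ) → Pt n) ∘
        ((MeasurableEquiv.piFinSuccAbove (fun _ : Fin (n + 1) => ℝ) 0).symm ∘
          Prod.map id WithLp.ofLp) := by
    funext p
    ext i
    refine Fin.cases ?_ (fun j => ?_) i <;>
      simp [consPt, MeasurableEquiv.piFinSuccAbove, Fin.insertNthEquiv]
  rw [e]
  exact h

/-- The isomorphism `(t, u) ↦ (t, u₁, …, uₙ)` of `ℝ × ℝⁿ` with `ℝⁿ⁺¹`. -/
noncomputable def consPtL (n : ℕ) : (ℝ × EuclideanSpace ℝ (Fin n)) ≃L[ℝ] Pt n :=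
  LinearEquiv.toContinuousLinearEquiv
    { toFun := fun p => consPt p.1 p.2
      invFun := fun y => (y 0, tailPt y)
      map_add' := fun p q => by ext i; refine Fin.cases ?_ (fun j => ?_) i <;> simp [consPt]
      map_smul' := fun a p => by ext i; refine Fin.cases ?_ (fun j => ?_) i <;> simp [consPt]
      left_inv := fun p => rfl
      right_inv := fun y => by
        ext i
        refine Fin.cases ?_ (fun j => ?_) i <;> simp [consPt, tailPt] }

/-- The determinant with columns `(w, ∂₁ψ, …, ∂ₙψ)` for the graph
parametrization `ψ(u) = (h(u), u)` with `D = Dh(u)`. -/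
theorem det_graph_tangent {n : ℕ} (w : Pt n) (D : EuclideanSpace ℝ (Fin n) →L[ℝ] ℝ) :
    Matrix.det (Matrix.of fun a b : Fin (n + 1) => (Fin.cons w (fun i : Fin n =>
      consPt (D (EuclideanSpace.single i 1)) (EuclideanSpace.single i 1)) : Fin (n + 1) → Pt n) b a)
      = w 0 - D (tailPt w) := by
  set N : Matrix (Fin (n + 1)) (Fin (n + 1)) ℝ := Matrix.of fun a b : Fin (n + 1) =>
    (Fin.cons w (fun i : Fin n =>
      consPt (D (EuclideanSpace.single i 1)) (EuclideanSpace.single i 1)) : Fin (n + 1) → Pt n) b a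
    with hN
  -- subtracting `∂ᵢh` times the `i`-th row from the first row leaves a triangular matrix
  let c : Fin (n + 1) → ℝ := Fin.cons 1 fun i => -D (EuclideanSpace.single i 1)
  have hdet : (N.updateRow 0 (∑ k, c k • N k)).det = N.det := by
    rw [Matrix.det_updateRow_sum]; simp [c]
  have hD : D (tailPt w) = ∑ i : Fin n, D (EuclideanSpace.single i 1) * w i.succ := by
    have : tailPt w = ∑ i : Fin n, w i.succ • EuclideanSpace.single i (1 : ℝ) := by
      simpa [tailPt] using ((EuclideanSpace.basisFun (Fin n) ℝ).sum_repr (tailPt w)).symm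
    rw [this, map_sum]
    simp [mul_comm]
  have hrow0 : (∑ k, c k • N k) 0 = w 0 - D (tailPt w) := by
    rw [hD, Fin.sum_univ_succ]
    simp [c, hN, Finset.sum_apply, sub_eq_add_neg]
  have hrow : ∀ j : Fin n, (∑ k, c k • N k) j.succ = 0 := by
    intro j
    rw [Fin.sum_univ_succ]
    simp [c, hN, Finset.sum_apply, consPt]
  rw [← hdet, Matrix.det_succ_row_zero, Fin.sum_univ_succ]
  simp only [Matrix.updateRow_self, hrow, hrow0, mul_zero, zero_mul, Finset.sum_const_zero,
    add_zero]
  have : (N.updateRow 0 (∑ k, c k • N k)).submatrix Fin.succ (Fin.succAbove 0) = 1 := by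
    ext a b
    simp [hN, consPt, Matrix.one_apply]
  rw [this]
  simp

namespace BoundaryChart

variable {n : ℕ} {Ω : Set (Pt n)} (c : BoundaryChart Ω)

/-- The coordinates `(t, u) ↦ A (t, u)` of a chart, in which `Ω` is the region `t < h u`. -/
noncomputable def coord : (ℝ × EuclideanSpace ℝ (Fin n)) ≃L[ℝ] Pt n :=
  (consPtL n).trans c.A.toContinuousLinearEquiv

theorem measurePreserving_coord :
    MeasurePreserving c.coord (volume.prod volume) volume :=
  c.A.measurePreserving.comp (measurePreserving_consPt n)

theorem coord_mem_iff {p : ℝ × EuclideanSpace ℝ (Fin n)} (hp : c.coord p ∈ c.W) :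
    c.coord p ∈ Ω ↔ p.1 < c.h p.2 := by
  rw [c.mem_iff _ hp]
  change (c.coord.symm (c.coord p)).1 < c.h (c.coord.symm (c.coord p)).2 ↔ _
  rw [ContinuousLinearEquiv.symm_apply_apply]

theorem continuous_h : Continuous c.h := c.lipschitz.choose_spec.continuous

theorem continuous_param : Continuous c.param :=
  c.coord.continuous.comp (c.continuous_h.prodMk continuous_id)

theorem tangent_eq {u : EuclideanSpace ℝ (Fin n)} (hu : DifferentiableAt ℝ c.h u) (i : Fin n) :
    c.tangent u i = c.A (consPt (fderiv ℝ c.h u (EuclideanSpace.single i 1))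
      (EuclideanSpace.single i 1)) := by
  have := c.coord.hasFDerivAt.comp u (hu.hasFDerivAt.prodMk (hasFDerivAt_id u))
  have h2 : HasFDerivAt c.param _ u := this
  rw [tangent, h2.fderiv]
  rfl

/-- Graph points in the window of a chart are boundary points. -/
theorem param_mem_frontier {u : EuclideanSpace ℝ (Fin n)} (hu : c.param u ∈ c.W) :
    c.param u ∈ frontier Ω := by
  have hcont : Continuous fun t : ℝ => c.coord (t, u) := by fun_prop
  refine ⟨?_, fun hint => ?_⟩
  · refine mem_closure_of_tendsto (b := 𝓝[<] c.h u)
      ((hcont.tendsto (c.h u)).mono_left nhdsWithin_le_nhds) ?_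
    filter_upwards [self_mem_nhdsWithin, nhdsWithin_le_nhds
      (hcont.continuousAt.preimage_mem_nhds (c.isOpen_W.mem_nhds hu))] with t ht htW
    exact (c.coord_mem_iff htW).2 ht
  · exact lt_irrefl _ ((c.coord_mem_iff (p := (c.h u, u)) hu).1 (interior_subset hint))

/-- An isometry has determinant `±1`. -/
theorem orientation_mul_self : c.orientation * c.orientation = 1 := by
  have h := c.A.toLinearIsometry.normDet_eq_one
  rw [LinearMap.normDet_eq_abs_det] at h
  have h' : |c.orientation| = 1 := h
  rw [← abs_mul_abs_self, h', one_mul]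

/-- The oriented surface element of a chart, contracted with a vector `F`, is the normal component
`F̃₀ - Dh(F̃')` of `F` in the coordinates of the chart. -/
theorem orientation_mul_sum_omitForm {u : EuclideanSpace ℝ (Fin n)}
    (hu : DifferentiableAt ℝ c.h u) (F : Pt n) :
    c.orientation * ∑ j : Fin (n + 1), (-1) ^ j.val * omitForm j (c.tangent u) * F j =
      (c.coord.symm F).1 - fderiv ℝ c.h u (c.coord.symm F).2 := by
  let w : Pt n := c.A.symm F
  let v : Fin (n + 1) → Pt n := Fin.cons w (fun i : Fin n =>
    consPt (fderiv ℝ c.h u (EuclideanSpace.single i 1)) (EuclideanSpace.single i 1))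
  let b := (EuclideanSpace.basisFun (Fin (n + 1)) ℝ).toBasis
  have h1 : b.det v = w 0 - fderiv ℝ c.h u (tailPt w) := by
    rw [← det_graph_tangent w (fderiv ℝ c.h u), Module.Basis.det_apply]
    rfl
  have h2 : ∑ j : Fin (n + 1), (-1) ^ j.val * omitForm j (c.tangent u) * F j =
      b.det ((c.A.toLinearEquiv : Pt n →ₗ[ℝ] Pt n) ∘ v) := by
    rw [Module.Basis.det_apply, Matrix.det_succ_column_zero]
    refine Finset.sum_congr rfl fun j _ => ?_
    have e1 : b.toMatrix ((c.A.toLinearEquiv : Pt n →ₗ[ℝ] Pt n) ∘ v) j 0 = F j := by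
      simp [b, Module.Basis.toMatrix_apply, v, w]
    have e2 : (b.toMatrix ((c.A.toLinearEquiv : Pt n →ₗ[ℝ] Pt n) ∘ v)).submatrix j.succAbove
        Fin.succ = Matrix.of fun a b : Fin n => c.tangent u b (j.succAbove a) := by
      ext a k
      simp [b, Module.Basis.toMatrix_apply, v, c.tangent_eq hu]
    rw [e1, e2, omitForm]
    ring
  rw [h2, Module.Basis.det_comp, h1, ← mul_assoc, ← orientation, orientation_mul_self, one_mul]
  rfl

end BoundaryChart

/-! ### The divergence theorem on a Lipschitz domain for weakly divergence-free fields -/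

/-- `F` is weakly divergence-free in `Ω`: the integral of `dφ(F)` vanishes for every test function
`φ`. Test functions are of class `C¹`, so that mollified graphs and step functions qualify. -/
def WeaklyDivergenceFree {n : ℕ} (Ω : Set (Pt n)) (F : Pt n → Pt n) : Prop :=
  ∀ φ : Pt n → ℝ, ContDiff ℝ 1 φ → HasCompactSupport φ → tsupport φ ⊆ Ω →
    ∫ y, fderiv ℝ φ y (F y) = 0

namespace BoundaryChart

variable {n : ℕ} {Ω : Set (Pt n)} (c : BoundaryChart Ω)

/-- `BoundaryChart.setIntegral_fderiv_apply` for compactly supported `χ`: the divergence theorem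
below a Lipschitz graph, pulled back by the coordinates of the chart. -/
theorem setIntegral_fderiv_apply_of_hasCompactSupport (ho : IsOpen Ω) {F : Pt n → Pt n}
    (hF : Continuous F) (hw : WeaklyDivergenceFree Ω F) {χ : Pt n → ℝ} (hχ : ContDiff ℝ 1 χ)
    (hχc : HasCompactSupport χ) (hχW : tsupport χ ⊆ c.W) :
    ∫ y in Ω, fderiv ℝ χ y (F y) = ∫ u, c.orientation * χ (c.param u) *
      ∑ j : Fin (n + 1), (-1) ^ j.val * omitForm j (c.tangent u) * F (c.param u) j := by
  obtain ⟨K, hK⟩ := c.lipschitz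
  let L := c.coord
  have hL : MeasurePreserving L (volume.prod volume) volume := c.measurePreserving_coord
  have hLe : MeasurableEmbedding L := L.toHomeomorph.measurableEmbedding
  have hder : ∀ (φ : ℝ × EuclideanSpace ℝ (Fin n) → ℝ) p v,
      fderiv ℝ (φ ∘ L.symm) (L p) v = fderiv ℝ φ p (L.symm v) := by
    intro φ p v
    rw [L.symm.comp_right_fderiv, L.symm_apply_apply]
    rfl
  have key := integral_subgraph_eq_of_weakly_divergence_free volume hK (W := L ⁻¹' c.W)
    (F := fun p => L.symm (F (L p))) (L.symm.continuous.comp (hF.comp L.continuous)) ?_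
    (χ := χ ∘ L) (hχ.comp L.contDiff) (hχc.comp_homeomorph L.toHomeomorph) ?_
  · have hl : ∫ p in {p : ℝ × EuclideanSpace ℝ (Fin n) | p.1 < c.h p.2},
        fderiv ℝ (χ ∘ L) p (L.symm (F (L p))) ∂(volume.prod volume) =
        ∫ y in Ω, fderiv ℝ χ y (F y) := by
      have hS : MeasurableSet {p : ℝ × EuclideanSpace ℝ (Fin n) | p.1 < c.h p.2} :=
        measurableSet_lt measurable_fst (c.continuous_h.measurable.comp measurable_snd)
      rw [← integral_indicator ho.measurableSet, ← hL.integral_comp hLe, ← integral_indicator hS]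
      refine integral_congr_ae (Eventually.of_forall fun p => ?_)
      have e : fderiv ℝ (χ ∘ L) p (L.symm (F (L p))) = fderiv ℝ χ (L p) (F (L p)) := by
        rw [L.comp_right_fderiv]
        simp
      beta_reduce
      by_cases hp : L p ∈ c.W
      · have hmem : L p ∈ Ω ↔ p.1 < c.h p.2 := c.coord_mem_iff hp
        by_cases hlt : p.1 < c.h p.2
        · rw [indicator_of_mem
              (show p ∈ {p : ℝ × EuclideanSpace ℝ (Fin n) | p.1 < c.h p.2} from hlt),
            indicator_of_mem (hmem.2 hlt)]
          exact e
        · rw [indicator_of_notMem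
              (show p ∉ {p : ℝ × EuclideanSpace ℝ (Fin n) | p.1 < c.h p.2} from hlt),
            indicator_of_notMem fun h => hlt (hmem.1 h)]
      · have h0 : fderiv ℝ χ (L p) (F (L p)) = 0 := by
          rw [show fderiv ℝ χ (L p) = 0 from
            image_eq_zero_of_notMem_tsupport fun h => hp (hχW (tsupport_fderiv_subset ℝ h))]
          rfl
        refine Eq.trans (b := 0) (indicator_apply_eq_zero.2 fun _ => e.trans h0) (Eq.symm ?_)
        exact indicator_apply_eq_zero.2 fun _ => h0
    rw [← hl, key]
    refine integral_congr_ae ?_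
    filter_upwards [hK.ae_differentiableAt] with u hu
    have := c.orientation_mul_sum_omitForm hu (F (c.param u))
    rw [mul_comm c.orientation, mul_assoc, this]
    rfl
  · intro φ hφ hφc hφs
    rw [← hw (φ ∘ L.symm) (hφ.comp L.symm.contDiff) (hφc.comp_homeomorph L.symm.toHomeomorph),
      ← hL.integral_comp hLe]
    · simp only [hder φ]
    · have h1 : tsupport (φ ∘ L.symm) = L.symm ⁻¹' tsupport φ :=
        tsupport_comp_eq_preimage φ L.symm.toHomeomorph
      intro y hy
      rw [h1] at hy
      have h2 := hφs hy
      have h3 := (c.coord_mem_iff (p := L.symm y) h2.1).2 h2.2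
      have h4 : c.coord (L.symm y) = y := L.apply_symm_apply y
      rwa [h4] at h3
  · have h1 : tsupport (χ ∘ L) = L ⁻¹' tsupport χ := tsupport_comp_eq_preimage χ L.toHomeomorph
    rw [h1]
    exact preimage_mono hχW

/-- The divergence theorem in a chart for a weakly divergence-free field `F`: as
`div (χ F) = dχ(F)`, the flux of `χ F` through the boundary is the integral of `dχ(F)`. -/
theorem setIntegral_fderiv_apply (ho : IsOpen Ω) (hb : Bornology.IsBounded Ω) {F : Pt n → Pt n}
    (hF : Continuous F) (hw : WeaklyDivergenceFree Ω F) {χ : Pt n → ℝ} (hχ : ContDiff ℝ 1 χ)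
    (hχW : tsupport χ ⊆ c.W) :
    ∫ y in Ω, fderiv ℝ χ y (F y) = ∫ u, c.orientation * χ (c.param u) *
      ∑ j : Fin (n + 1), (-1) ^ j.val * omitForm j (c.tangent u) * F (c.param u) j := by
  obtain ⟨R, hR⟩ := hb.closure.subset_closedBall (0 : Pt n)
  -- a cut-off function that is `1` near the closure of `Ω`
  let θ : ContDiffBump (0 : Pt n) := ⟨|R| + 1, |R| + 2, by positivity, by linarith⟩
  have hθ : ∀ y ∈ closure Ω, (fun y => θ y * χ y) =ᶠ[𝓝 y] χ := by
    intro y hy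
    have : Metric.ball (0 : Pt n) (|R| + 1) ∈ 𝓝 y := by
      refine Metric.isOpen_ball.mem_nhds (Metric.mem_ball.2 ?_)
      exact ((Metric.mem_closedBall.1 (hR hy)).trans (le_abs_self R)).trans_lt (lt_add_one _)
    filter_upwards [this] with z hz
    rw [θ.one_of_mem_closedBall (Metric.ball_subset_closedBall hz), one_mul]
  have key := c.setIntegral_fderiv_apply_of_hasCompactSupport ho hF hw
    (χ := fun y => θ y * χ y) (θ.contDiff.mul hχ) θ.hasCompactSupport.mul_right
    ((tsupport_mul_subset_right).trans hχW)
  have hcongr : EqOn (fun y => fderiv ℝ χ y (F y))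
      (fun y => fderiv ℝ (fun y => θ y * χ y) y (F y)) Ω := fun y hy => by
    simp only [(hθ y (subset_closure hy)).fderiv_eq]
  rw [setIntegral_congr_fun ho.measurableSet hcongr, key]
  refine integral_congr_ae (Eventually.of_forall fun u => ?_)
  have : θ (c.param u) * χ (c.param u) = χ (c.param u) := by
    by_cases hu : c.param u ∈ c.W
    · exact (hθ _ (frontier_subset_closure (c.param_mem_frontier hu))).eq_of_nhds
    · rw [image_eq_zero_of_notMem_tsupport fun h => hu (hχW h), mul_zero]
  simp only [this]

end BoundaryChart

/-- The total flux of a weakly divergence-free field through the boundary vanishes: by the partition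
of unity it is the integral of `d(∑ χ_k - 1)(F)`, and `∑ χ_k - 1`, restricted to `Ω`, is a test
function. -/
theorem BoundaryAtlas.sum_flux_eq_zero {n : ℕ} {Ω : Set (Pt n)} (𝒜 : BoundaryAtlas Ω)
    (ho : IsOpen Ω) (hb : Bornology.IsBounded Ω) {F : Pt n → Pt n}
    (hF : Continuous F) (hw : WeaklyDivergenceFree Ω F) :
    ∑ k, ∫ u, (𝒜.chart k).orientation * 𝒜.χ k ((𝒜.chart k).param u) *
      ∑ j : Fin (n + 1), (-1) ^ j.val * omitForm j ((𝒜.chart k).tangent u) *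
        F ((𝒜.chart k).param u) j = 0 := by
  have hχ : ∀ k, ContDiff ℝ 1 (𝒜.χ k) := fun k => (𝒜.smooth k).of_le (by exact_mod_cast le_top)
  have hcl : IsCompact (closure Ω) := hb.isCompact_closure
  have hint : ∀ k, IntegrableOn (fun y => fderiv ℝ (𝒜.χ k) y (F y)) Ω := fun k =>
    ((((hχ k).continuous_fderiv one_ne_zero).clm_apply hF).continuousOn.integrableOn_compact
      hcl).mono_set subset_closure
  simp only [← fun k => (𝒜.chart k).setIntegral_fderiv_apply ho hb hF hw (hχ k)
    (𝒜.tsupport_subset k)]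
  rw [← integral_finsetSum _ fun k _ => hint k]
  obtain ⟨U, hUo, hU, hU1⟩ := eventually_nhdsSet_iff_exists.1 𝒜.sum_eq_one
  let ψ : Pt n → ℝ := fun y => ∑ k, 𝒜.χ k y - 1
  have hψ : ContDiff ℝ 1 ψ := (ContDiff.sum fun k _ => hχ k).sub contDiff_const
  let φ : Pt n → ℝ := Ω.indicator ψ
  -- `ψ` vanishes on the neighbourhood `U` of the boundary
  have hts : tsupport φ ⊆ Ω \ U := by
    have hsub : support φ ⊆ closure Ω \ U := by
      intro y hy
      have hyΩ : y ∈ Ω := by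
        by_contra h
        exact hy (indicator_of_notMem h _)
      refine ⟨subset_closure hyΩ, fun hyU => hy ?_⟩
      simp [φ, ψ, hU1 y hyU]
    refine (closure_minimal hsub (isClosed_closure.sdiff hUo)).trans fun y hy => ⟨?_, hy.2⟩
    by_contra h
    exact hy.2 (hU ⟨hy.1, by rwa [ho.interior_eq]⟩)
  have hφΩ : ∀ y ∈ Ω, φ =ᶠ[𝓝 y] ψ := fun y hy => by
    filter_upwards [ho.mem_nhds hy] with z hz using indicator_of_mem hz _
  have hφ0 : ∀ y ∉ Ω, φ =ᶠ[𝓝 y] 0 := fun y hy =>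
    notMem_tsupport_iff_eventuallyEq.1 fun h => hy (hts h).1
  have hφ : ContDiff ℝ 1 φ := contDiff_iff_contDiffAt.2 fun y => by
    by_cases hy : y ∈ Ω
    · exact hψ.contDiffAt.congr_of_eventuallyEq (hφΩ y hy)
    · exact contDiffAt_const.congr_of_eventuallyEq (hφ0 y hy)
  have hφc : HasCompactSupport φ :=
    hcl.of_isClosed_subset (isClosed_tsupport φ) ((hts.trans sdiff_subset).trans subset_closure)
  have hφ' : ∀ y ∉ Ω, fderiv ℝ φ y (F y) = 0 := fun y hy => by
    rw [(hφ0 y hy).fderiv_eq, fderiv_zero]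
    rfl
  rw [← hw φ hφ hφc (hts.trans sdiff_subset), ← setIntegral_eq_integral_of_forall_compl_eq_zero hφ']
  refine setIntegral_congr_fun ho.measurableSet fun y hy => ?_
  have h1 : HasFDerivAt ψ (∑ k, fderiv ℝ (𝒜.χ k) y) y :=
    (HasFDerivAt.fun_sum fun k _ => ((hχ k).differentiable one_ne_zero y).hasFDerivAt).sub_const 1
  simp only [(hφΩ y hy).fderiv_eq, h1.fderiv, sum_apply]

/-- Tietze's extension theorem, coordinate by coordinate. -/
theorem ContinuousOn.exists_continuous_eqOn {n : ℕ} {s : Set (Pt n)} (hs : IsClosed s)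
    {F : Pt n → Pt n} (hF : ContinuousOn F s) : ∃ G : Pt n → Pt n, Continuous G ∧ EqOn G F s := by
  have hc : Continuous fun x : s => (F x).ofLp :=
    (PiLp.continuous_ofLp 2 _).comp hF.domRestrict
  obtain ⟨g, hg⟩ := ContinuousMap.exists_restrict_eq hs (⟨_, hc⟩ : C(s, Fin (n + 1) → ℝ))
  refine ⟨fun y => WithLp.toLp 2 (g y), (PiLp.continuous_toLp 2 _).comp g.continuous,
    fun y hy => ?_⟩
  have := DFunLike.congr_fun hg ⟨y, hy⟩
  ext i
  exact congrFun this i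

/-- The divergence theorem on a bounded Lipschitz domain for a vector field that is continuous up to
the boundary and has vanishing divergence in the interior, where it is only assumed to be
differentiable. -/
theorem BoundaryAtlas.sum_flux_eq_zero_of_divergence_eq_zero {n : ℕ} {Ω : Set (Pt n)}
    (𝒜 : BoundaryAtlas Ω) (hΩ : IsLipschitzDomain Ω) {F : Pt n → Pt n}
    (hF : ContinuousOn F (closure Ω)) (hd : DifferentiableOn ℝ F Ω)
    (hdiv : ∀ y ∈ Ω, ∑ i, fderiv ℝ F y (EuclideanSpace.single i 1) i = 0) :
    ∑ k, ∫ u, (𝒜.chart k).orientation * 𝒜.χ k ((𝒜.chart k).param u) *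
      ∑ j : Fin (n + 1), (-1) ^ j.val * omitForm j ((𝒜.chart k).tangent u) *
        F ((𝒜.chart k).param u) j = 0 := by
  obtain ⟨G, hG, hGF⟩ := hF.exists_continuous_eqOn isClosed_closure
  have hw : WeaklyDivergenceFree Ω G := fun φ hφ hφc hφΩ =>
    integral_fderiv_apply_eq_zero_of_divergence_eq_zero hΩ.isOpen hG
      (hd.congr fun y hy => hGF (subset_closure hy)) (fun y hy => by
        have : G =ᶠ[𝓝 y] F := by
          filter_upwards [hΩ.isOpen.mem_nhds hy] with z hz using hGF (subset_closure hz)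
        rw [this.fderiv_eq]
        exact hdiv y hy) hφ hφc hφΩ
  rw [← 𝒜.sum_flux_eq_zero hΩ.isOpen hΩ.isBounded hG hw]
  refine Finset.sum_congr rfl fun k _ => integral_congr_ae (Eventually.of_forall fun u => ?_)
  by_cases hu : (𝒜.chart k).param u ∈ (𝒜.chart k).W
  · simp only [hGF (frontier_subset_closure ((𝒜.chart k).param_mem_frontier hu))]
  · simp only [image_eq_zero_of_notMem_tsupport fun h => hu (𝒜.tsupport_subset k h), mul_zero,
      zero_mul]

/-! ### Integrability of the boundary integrand -/

section Module

variable {n : ℕ} {s : ℝ} {V : Type*} [NormedAddCommGroup V] [NormedSpace ℝ V] [Module (Cl n s) V]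
  [IsScalarTower ℝ (Cl n s) V] [ContinuousConstSMul (Cl n s) V]

/-- The action of a Clifford number as a bounded operator. -/
noncomputable def cliffordAct (a : Cl n s) : V →L[ℝ] V :=
  letI : SMulCommClass (Cl n s) ℝ V := IsScalarTower.to_smulCommClass'
  { toFun := fun x => a • x
    map_add' := smul_add a
    map_smul' := fun r x => smul_comm a r x
    cont := continuous_const_smul a }

theorem cliffordAct_apply (a : Cl n s) (x : V) : cliffordAct a x = a • x := rfl

/-- The operators `1, -e₁, …, -eₙ`: `dσ g` is the contraction of the volume form with the vector
field of components `g, -e₁g, …, -eₙg`. -/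
noncomputable def fieldCoeff (n : ℕ) (s : ℝ) (V : Type*) [NormedAddCommGroup V] [NormedSpace ℝ V]
    [Module (Cl n s) V] [IsScalarTower ℝ (Cl n s) V] [ContinuousConstSMul (Cl n s) V] :
    Fin (n + 1) → V →L[ℝ] V :=
  Fin.cons (ContinuousLinearMap.id ℝ V) fun j => -cliffordAct (gen n s j)

theorem dσ_smul_eq_sum (v : Fin n → Pt n) (x : V) :
    dσ s v • x = ∑ j : Fin (n + 1), ((-1) ^ j.val * omitForm j v) • fieldCoeff n s V j x := by
  rw [dσ, sub_smul, Finset.sum_smul, algebraMap_smul, Fin.sum_univ_succ]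
  simp [fieldCoeff, cliffordAct_apply, sub_eq_add_neg, pow_succ]

end Module

theorem continuous_omitForm {n : ℕ} (j : Fin (n + 1)) :
    Continuous (omitForm j : (Fin n → Pt n) → ℝ) := by
  unfold omitForm
  refine Continuous.matrix_det ?_
  refine continuous_matrix fun a b => ?_
  simp only [Matrix.of_apply]
  fun_prop

namespace BoundaryChart

variable {n : ℕ} {Ω : Set (Pt n)} (c : BoundaryChart Ω)

theorem exists_lipschitzWith_param : ∃ K, LipschitzWith K c.param := by
  obtain ⟨K, hK⟩ := c.lipschitz
  have e : c.param = (c.coord : _ →L[ℝ] Pt n) ∘ fun u => (c.h u, id u) := rfl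
  have h := (c.coord : _ →L[ℝ] Pt n).lipschitz.comp (hK.prodMk LipschitzWith.id)
  rw [← e] at h
  exact ⟨_, h⟩

theorem measurable_tangent : Measurable c.tangent :=
  measurable_pi_lambda _ fun _ => measurable_fderiv_apply_const ℝ c.param _

/-- The tangent vectors are bounded because the parametrization is Lipschitz; at points where it is
not differentiable they are `0`. -/
theorem exists_forall_abs_omitForm_tangent_le (j : Fin (n + 1)) :
    ∃ C, ∀ u, ‖omitForm j (c.tangent u)‖ ≤ C := by
  obtain ⟨K, hK⟩ := c.exists_lipschitzWith_param
  obtain ⟨C, hC⟩ := (isCompact_closedBall (0 : Fin n → Pt n) K).exists_bound_of_continuousOn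
    (continuous_omitForm j).continuousOn
  refine ⟨C, fun u => hC _ (mem_closedBall_zero_iff.2 ((pi_norm_le_iff_of_nonneg K.coe_nonneg).2
    fun i => ?_))⟩
  have h1 := (fderiv ℝ c.param u).le_of_opNorm_le (norm_fderiv_le_of_lipschitz ℝ hK)
    (EuclideanSpace.single i 1)
  simpa [tangent] using h1

/-- For `g` continuous up to the boundary and `χ` supported in the window of a chart, `χ g` is
continuous with compact support in the coordinates of the chart. -/
theorem continuous_smul_comp_param {V : Type*} [NormedAddCommGroup V] [NormedSpace ℝ V]
    (hb : Bornology.IsBounded Ω) {χ : Pt n → ℝ} (hχ : Continuous χ) (hχW : tsupport χ ⊆ c.W)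
    {g : Pt n → V} (hg : ContinuousOn g (closure Ω)) :
    Continuous (fun u => χ (c.param u) • g (c.param u)) ∧
      HasCompactSupport fun u => χ (c.param u) • g (c.param u) := by
  have hts : tsupport (fun u => χ (c.param u)) ⊆ c.param ⁻¹' tsupport χ :=
    closure_minimal (fun u hu => subset_tsupport χ hu)
      ((isClosed_tsupport χ).preimage c.continuous_param)
  constructor
  · refine continuous_of_tsupport fun u hu => ?_
    have huW : c.param u ∈ c.W := hχW (hts (tsupport_smul_subset_left _ _ hu))
    have hopen : IsOpen (c.param ⁻¹' c.W) := c.isOpen_W.preimage c.continuous_param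
    have hgc : ContinuousOn (fun u => g (c.param u)) (c.param ⁻¹' c.W) :=
      hg.comp c.continuous_param.continuousOn fun v hv =>
        frontier_subset_closure (c.param_mem_frontier hv)
    exact (hχ.comp c.continuous_param).continuousAt.smul (hgc.continuousAt (hopen.mem_nhds huW))
  · have hsnd : Continuous fun y => (c.coord.symm y).2 :=
      continuous_snd.comp c.coord.symm.continuous
    refine HasCompactSupport.intro (hb.isCompact_closure.image hsnd) fun u hu => ?_
    rw [image_eq_zero_of_notMem_tsupport (f := χ), zero_smul]
    refine fun h => hu ⟨c.param u, frontier_subset_closure (c.param_mem_frontier (hχW h)), ?_⟩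
    change (c.coord.symm (c.coord (c.h u, u))).2 = u
    rw [c.coord.symm_apply_apply]

end BoundaryChart

namespace BoundaryAtlas

variable {n : ℕ} {Ω : Set (Pt n)} (𝒜 : BoundaryAtlas Ω) {s : ℝ} {V : Type*}
  [NormedAddCommGroup V] [NormedSpace ℝ V] [Module (Cl n s) V]
  [IsScalarTower ℝ (Cl n s) V] [ContinuousConstSMul (Cl n s) V]

theorem integrand_eq_sum (g : Pt n → V) (k : Fin 𝒜.m) (u : EuclideanSpace ℝ (Fin n)) :
    𝒜.integrand s g k u = ∑ j : Fin (n + 1),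
      ((𝒜.chart k).orientation * ((-1) ^ j.val * omitForm j ((𝒜.chart k).tangent u))) •
        (𝒜.χ k ((𝒜.chart k).param u) • fieldCoeff n s V j (g ((𝒜.chart k).param u))) := by
  rw [integrand, dσ_smul_eq_sum, Finset.smul_sum]
  refine Finset.sum_congr rfl fun j _ => ?_
  simp only [smul_smul]
  congr 1
  ring

theorem integrable_integrand (hb : Bornology.IsBounded Ω) {g : Pt n → V}
    (hg : ContinuousOn g (closure Ω)) (k : Fin 𝒜.m) : Integrable (𝒜.integrand s g k) := by
  simp only [funext (𝒜.integrand_eq_sum g k)]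
  refine integrable_finsetSum _ fun j _ => ?_
  obtain ⟨h1, h2⟩ := (𝒜.chart k).continuous_smul_comp_param hb (𝒜.smooth k).continuous
    (𝒜.tsupport_subset k) ((fieldCoeff n s V j).continuous.comp_continuousOn hg)
  obtain ⟨C, hC⟩ := (𝒜.chart k).exists_forall_abs_omitForm_tangent_le j
  refine (h1.integrable_of_hasCompactSupport h2).bdd_smul
    (C := |(𝒜.chart k).orientation| * C) ?_ (Eventually.of_forall fun u => ?_)
  · exact ((((continuous_omitForm j).measurable.comp
      (𝒜.chart k).measurable_tangent).const_mul _).const_mul _).aestronglyMeasurable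
  · rw [norm_mul, norm_mul]
    simpa using mul_le_mul_of_nonneg_left (hC u) (abs_nonneg _)

/-- Cauchy's theorem for the massless Dirac equation `∂₀g = ∑ e_j ∂_j g`. Applying a functional `ℓ`
reduces it to the divergence theorem for the real vector field `(ℓ(g), -ℓ(e₁g), …, -ℓ(eₙg))`. -/
theorem hasBoundaryIntegral_zero_of_dirac [CompleteSpace V] (hΩ : IsLipschitzDomain Ω)
    {g : Pt n → V} (hg : ContinuousOn g (closure Ω)) (hd : DifferentiableOn ℝ g Ω)
    (hD : ∀ y ∈ Ω, pderivAt g 0 y = ∑ j : Fin n, gen n s j • pderivAt g j.succ y) :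
    𝒜.HasBoundaryIntegral s g 0 := by
  have hint := fun k => 𝒜.integrable_integrand (s := s) hΩ.isBounded hg k
  refine ⟨hint, ?_⟩
  refine SeparatingDual.eq_zero_of_forall_dual_eq_zero (R := ℝ) fun ℓ => ?_
  let T : Fin (n + 1) → V →L[ℝ] ℝ := fun j => ℓ.comp (fieldCoeff n s V j)
  let F : Pt n → Pt n := fun y => WithLp.toLp 2 fun j => T j (g y)
  have hF : ContinuousOn F (closure Ω) := (PiLp.continuous_toLp 2 _).comp_continuousOn
    (continuousOn_pi.2 fun j => (T j).continuous.comp_continuousOn hg)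
  have hFd : ∀ y ∈ Ω, ∃ F' : Pt n →L[ℝ] Pt n, HasFDerivAt F F' y ∧
      ∀ v i, F' v i = T i (fderiv ℝ g y v) := by
    intro y hy
    have h1 := ((hd y hy).differentiableAt (hΩ.isOpen.mem_nhds hy)).hasFDerivAt
    have h2 := hasFDerivAt_pi.2 fun j => (T j).hasFDerivAt.comp y h1
    exact ⟨_, (PiLp.continuousLinearEquiv 2 ℝ fun _ : Fin (n + 1) => ℝ).symm.hasFDerivAt.comp y h2,
      fun v i => rfl⟩
  have key := 𝒜.sum_flux_eq_zero_of_divergence_eq_zero hΩ hF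
    (fun y hy => (hFd y hy).choose_spec.1.differentiableAt.differentiableWithinAt) ?_
  · rw [← key, map_sum]
    refine Finset.sum_congr rfl fun k _ => ?_
    rw [← ℓ.integral_comp_comm (hint k)]
    refine integral_congr_ae (Eventually.of_forall fun u => ?_)
    simp only [𝒜.integrand_eq_sum, map_sum, map_smul, smul_eq_mul, Finset.mul_sum]
    refine Finset.sum_congr rfl fun j _ => ?_
    simp only [F, T, ContinuousLinearMap.comp_apply]
    ring
  · intro y hy
    obtain ⟨F', hF', hF'v⟩ := hFd y hy
    simp only [hF'.fderiv, hF'v]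
    have h0 := hD y hy
    simp only [pderivAt] at h0
    rw [Fin.sum_univ_succ]
    simp only [T, fieldCoeff, Fin.cons_zero, Fin.cons_succ, ContinuousLinearMap.comp_apply,
      ContinuousLinearMap.id_apply, h0, map_sum, neg_apply, map_neg,
      cliffordAct_apply, Finset.sum_neg_distrib, add_neg_cancel]

end BoundaryAtlas

/-! ### Removing the mass term -/

/-- Multiplication by `e^{-y₀M}` removes the mass term. -/
theorem hasBoundaryIntegral_exp_smul_apply {n : ℕ} {s : ℝ} {Ω : Set (Pt n)}
    (hΩ : IsLipschitzDomain Ω) (𝒜 : BoundaryAtlas Ω) {V : Type*} [NormedAddCommGroup V]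
    [NormedSpace ℝ V] [CompleteSpace V] [Module (Cl n s) V] [IsScalarTower ℝ (Cl n s) V]
    [ContinuousConstSMul (Cl n s) V] (M : V →L[ℝ] V)
    (hM : ∀ (j : Fin n) (x : V), M (gen n s j • x) = gen n s j • M x)
    {f : Pt n → V} (hf : f ∈ massiveDirac s Ω M) :
    𝒜.HasBoundaryIntegral s (fun y => NormedSpace.exp (-(y 0) • M) (f y)) 0 := by
  obtain ⟨hfc, hfd, hfD⟩ := hf
  have hE : ∀ y : Pt n, HasFDerivAt (fun y : Pt n => NormedSpace.exp (-(y 0) • M))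
      ((-(EuclideanSpace.proj (𝕜 := ℝ) (0 : Fin (n + 1)))).smulRight
        (NormedSpace.exp (-(y 0) • M) * M)) y := by
    intro y
    have h1 := hasDerivAt_exp_smul_const (𝕂 := ℝ) M (-(y 0))
    have h2 : HasFDerivAt (fun y : Pt n => -(y 0))
        (-(EuclideanSpace.proj (𝕜 := ℝ) (0 : Fin (n + 1)))) y :=
      (EuclideanSpace.proj (𝕜 := ℝ) (0 : Fin (n + 1))).hasFDerivAt.neg
    refine (h1.hasFDerivAt.comp y h2).congr_fderiv (ContinuousLinearMap.ext fun v => ?_)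
    simp
  have hder : ∀ y ∈ Ω, HasFDerivAt (fun y => NormedSpace.exp (-(y 0) • M) (f y)) _ y :=
    fun y hy => (hE y).clm_apply
      ((hfd y hy).differentiableAt (hΩ.isOpen.mem_nhds hy)).hasFDerivAt
  -- the exponential of `t M` commutes with the Clifford action, as `M` does
  have hcomm : ∀ (t : ℝ) (j : Fin n) (x : V), NormedSpace.exp (t • M) (gen n s j • x) =
      gen n s j • NormedSpace.exp (t • M) x := by
    intro t j x
    have h1 : Commute (cliffordAct (gen n s j) : V →L[ℝ] V) M := by
      ext z
      exact (hM j z).symm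
    exact (DFunLike.congr_fun (h1.smul_right t).exp_right x).symm
  refine 𝒜.hasBoundaryIntegral_zero_of_dirac hΩ ?_
    (fun y hy => (hder y hy).differentiableAt.differentiableWithinAt) fun y hy => ?_
  · exact (continuous_iff_continuousAt.2 fun y => (hE y).continuousAt).continuousOn.clm_apply hfc
  · have h0 := hfD y hy
    simp only [pderivAt] at h0 ⊢
    rw [(hder y hy).fderiv]
    simp only [h0, add_apply, ContinuousLinearMap.comp_apply, ContinuousLinearMap.flip_apply,
      ContinuousLinearMap.smulRight_apply, neg_apply, map_add, map_sum, hcomm]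
    simp

theorem exp_smul_rightMul_apply {n : ℕ} {s : ℝ} (l : Cl n s) (t : ℝ) (a : Cl n s) :
    NormedSpace.exp (t • rightMul l) a = a * NormedSpace.exp (t • l) := by
  have : FiniteDimensional ℝ (Cl n s) := (cliffordBasis n s).finiteDimensional_of_finite
  have : CompleteSpace (Cl n s) := FiniteDimensional.complete ℝ _
  have hpow : ∀ m : ℕ, ((t • rightMul l) ^ m) a = a * (t • l) ^ m := by
    intro m
    induction m with
    | zero => simp
    | succ m ih =>
      rw [pow_succ', mul_apply_eq_comp, ih, pow_succ, ← mul_assoc]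
      simp [rightMul_apply]
  have h1 := (NormedSpace.exp_series_hasSum_exp' (𝕂 := ℝ) (t • rightMul l)).mapL
    (ContinuousLinearMap.apply ℝ (Cl n s) a)
  have h2 := (NormedSpace.exp_series_hasSum_exp' (𝕂 := ℝ) (t • l)).mul_left a
  refine h1.unique (h2.congr_fun fun m => ?_)
  simp [hpow]

end

theorem mainTheorem7 (n : ℕ) (s : ℝ) (Ω : Set (Pt n)) (hΩ : IsLipschitzDomain Ω)
    (𝒜 : BoundaryAtlas Ω) :
    (∀ (V : Type*) [NormedAddCommGroup V] [NormedSpace ℝ V] [CompleteSpace V]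
        [Module (Cl n s) V] [IsScalarTower ℝ (Cl n s) V] [ContinuousConstSMul (Cl n s) V]
        (M : V →L[ℝ] V), (∀ (j : Fin n) (x : V), M (gen n s j • x) = gen n s j • M x) →
        ∀ f ∈ massiveDirac s Ω M,
          𝒜.HasBoundaryIntegral s (fun y => NormedSpace.exp (-(y 0) • M) (f y)) 0) ∧
      (∀ (l : Cl n s), ∀ f ∈ massiveDirac s Ω (rightMul l),
        𝒜.HasBoundaryIntegral s (fun y => f y * NormedSpace.exp (-(y 0) • l)) 0) ∧
      (∀ (l : ℝ), ∀ f ∈ massiveDirac s Ω (rightMul (algebraMap ℝ (Cl n s) l)),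
        𝒜.HasBoundaryIntegral s
          (fun y => algebraMap ℝ (Cl n s) (Real.exp (-(y 0) * l)) * f y) 0) := by
  have hfin : FiniteDimensional ℝ (Cl n s) := (cliffordBasis n s).finiteDimensional_of_finite
  have hcomplete : CompleteSpace (Cl n s) := FiniteDimensional.complete ℝ _
  have hright : ∀ (l : Cl n s), ∀ f ∈ massiveDirac s Ω (rightMul l),
      𝒜.HasBoundaryIntegral s (fun y => f y * NormedSpace.exp (-(y 0) • l)) 0 := by
    intro l f hf
    simpa only [exp_smul_rightMul_apply] using hasBoundaryIntegral_exp_smul_apply hΩ 𝒜 (rightMul l)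
      (fun j x => by simp only [rightMul_apply, smul_eq_mul, mul_assoc]) hf
  refine ⟨?_, hright, ?_⟩
  · intro V _ _ _ _ _ _ M hM f hf
    exact hasBoundaryIntegral_exp_smul_apply hΩ 𝒜 M hM hf
  · intro l f hf
    have hexp : ∀ t : ℝ, NormedSpace.exp (t • algebraMap ℝ (Cl n s) l) =
        algebraMap ℝ (Cl n s) (Real.exp (t * l)) := by
      intro t
      rw [Real.exp_eq_exp_ℝ, NormedSpace.algebraMap_exp_comm, map_mul, Algebra.smul_def]
    have h := hright _ f hf
    simp only [hexp] at h
    simpa only [Algebra.commutes] using h
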